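/- Let $q$ be a prime power, let $\ell\ge 1$ and $k\ge 1$, let $S_1$ be a one-dimensional subspace and $S_u$ a $u$-dimensional subspace of $\mathbb F_q^k$ with $S_u\cap S_1=\{0\}$, and suppose that $(q,k,u)\neq(2,2,1)$. Let $G$ be a matrix whose columns are the vectors of $\mathbb F_q^k\setminus(S_u\cup S_1)$, each occurring once, and let $C$ be the linear code over $\mathbb F_q$ generated by the rows of $G$. Let the lifted code $C_\ell$ be the linear code over $\mathbb F_{q^\ell}$ generated by the rows of the same matrix $G$. Write $\begin{bmatrix} a\\ b\end{bmatrix}=\prod_{r=0}^{b-1}\frac{q^a-q^r}{q^b-q^r}$ for the Gaussian binomial coefficient (equal to $1$ if $b=0$ and to $0$ if $b<0$). Then $C_\ell$ has length $n=q^k-q^u-q+1$, and its weight enumerator polynomial (the sum over $0\le i\le n$ of the number of codewords of Hamming weight $i$ times $z^i$) is $$A_\ell(z)=1+\sum_{i=1}^n\sum_{j=1}^k A_i^{(j)}(q^\ell-1)(q^\ell-q)\cdots(q^\ell-q^{j-1})z^i .$$ Here, for $1\le i\le n$ and $1\le j\le k$, $A_i^{(j)}$ is the number of $(k-j)$-dimensional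 subspaces of $\mathbb F_q^k$ which contain exactly $n-i$ of the columns of $G$; it is also the number of $j$-dimensional subcodes of $C$ with support weight $i$ (the support weight of a subcode is the number of coordinates in which some word of it is nonzero). It is given by $$A_i^{(j)}=\begin{cases} q^{u(k-j-1)}\left(\begin{bmatrix}u\\1\end{bmatrix}+1\right)\begin{bmatrix}k-u-1\\k-j-1\end{bmatrix}+q^{(u-1)(k-j-2)}\dfrac{(q^u-1)(q^{u-1}-1)}{q-1}\begin{bmatrix}k-u-1\\k-j-2\end{bmatrix}, & \text{if } n-i=q^{k-j}-q,\\[3mm] q^{(u-t)(k-j-t-1)}\begin{bmatrix}u\\t\end{bmatrix}\left(q^{u-t}\begin{bmatrix}k-u\\k-j-t\end{bmatrix}-\begin{bmatrix}k-u-1\\k-j-t-1\end{bmatrix}\right), & \text{if } n-i=q^{k-j}-q^t,\ t\neq 1,\\[3mm] q^{(u-t)(k-j-t-1)}\begin{bmatrix}k-u-1\\k-j-t-1\end{bmatrix}\begin{bmatrix}u\\t\end{bmatrix}, & \text{if } n-i=q^{k-j}-q^t-q+1,\ t\neq 0,\\[3mm] 0, & \text{otherwise,} \end{cases}$$ where $t$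 ranges over the non-negative integers. -/

import Mathlib

open scoped Polynomial

/-- The Gaussian (`q`-)binomial coefficient `[n, m]_q`, as a rational number:
`∏_{r < m} (q^n - q^r) / (q^m - q^r)`, equal to `1` for `m = 0` and, by convention, to `0` for
`m < 0`. The entries are integers, so that no subtraction is truncated. -/
noncomputable def gaussBinom (q : ℕ) (n m : ℤ) : ℚ :=
  if m < 0 then 0
  else ∏ r ∈ Finset.range m.toNat, ((q : ℚ) ^ n - (q : ℚ) ^ r) / ((q : ℚ) ^ m - (q : ℚ) ^ r)

/-- `G` is a matrix `[T]`: its columns are the elements of the set `T` of vectors,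
each of them occurring exactly once, in an arbitrary order. -/
def IsColumnMatrix {K : Type*} {k n : ℕ} (G : Matrix (Fin k) (Fin n) K)
    (T : Set (Fin k → K)) : Prop :=
  Function.Injective G.col ∧ Set.range G.col = T

/-- The linear code over `K` generated by (the rows of) a matrix `G`. -/
def rowCode {K : Type*} [Field K] {k n : ℕ} (G : Matrix (Fin k) (Fin n) K) :
    Submodule K (Fin n → K) :=
  Submodule.span K (Set.range G.row)

/-- The lifted code: the linear code over the extension field `L` generated by the same matrix. -/
def liftedCode {F : Type*} (L : Type*) [Field F] [Field L] [Algebra F L] {k n : ℕ}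
    (G : Matrix (Fin k) (Fin n) F) : Submodule L (Fin n → L) :=
  rowCode (G.map (algebraMap F L))

open Classical in
/-- The number of codewords of Hamming weight `i`. -/
noncomputable def weightCount {K : Type*} [Field K] {n : ℕ} (C : Submodule K (Fin n → K))
    (i : ℕ) : ℕ :=
  Set.ncard {c : Fin n → K | c ∈ C ∧ hammingNorm c = i}

/-- The weight enumerator polynomial `∑_{i = 0}^{n} A_i z^i`. -/
noncomputable def weightEnumerator {K : Type*} [Field K] {n : ℕ} (C : Submodule K (Fin n → K)) :
    ℚ[X] :=
  ∑ i ∈ Finset.range (n + 1), Polynomial.C (weightCount C i : ℚ) * Polynomial.X ^ i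

/-- The support weight of a code `D`: the number of coordinates in which some codeword of `D`
is nonzero. -/
noncomputable def supportWeight {K : Type*} [Field K] {n : ℕ} (D : Submodule K (Fin n → K)) : ℕ :=
  Set.ncard {s : Fin n | ∃ c ∈ D, c s ≠ 0}

/-- The number of `j`-dimensional subcodes of `C` with support weight `i`. -/
noncomputable def subcodeCount {K : Type*} [Field K] {n : ℕ} (C : Submodule K (Fin n → K))
    (j i : ℕ) : ℕ :=
  Set.ncard {D : Submodule K (Fin n → K) |
    D ≤ C ∧ Module.finrank K D = j ∧ supportWeight D = i}

/-- The number of `d`-dimensional subspaces of `K^k` which contain exactly `m` of the columns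
of `G`. -/
noncomputable def subspaceCount {K : Type*} [Field K] {k n : ℕ} (G : Matrix (Fin k) (Fin n) K)
    (d m : ℕ) : ℕ :=
  Set.ncard {V : Submodule K (Fin k → K) |
    Module.finrank K V = d ∧ Set.ncard {s : Fin n | G.col s ∈ V} = m}

/-! Write `F` for the small field, `L` for its extension of degree `l`. A word of the lifted code
lists the values at the columns of an `F`-linear map `f : F^k → L`, so its weight is `n` minus the
number of columns in `ker f`. The number of `f` with kernel `V` depends only on the codimension `j`
of `V` and is the product in the enumerator; `weightCount_liftedCode` then reduces weights to
`subspaceCount`. This needs the columns to span `F^k` (`colEval_injective`). Subcodes are handled by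
the duality `V ↦` evaluations of the annihilator of `V`.

Inclusion–exclusion (`ncard_col_mem`) shows that the number of columns in `V` depends only on `dim
V`, `t = dim (V ∩ S_u)` and whether `S₁ ≤ V`. At a fixed dimension, different types give the same
number only for `t = 1` without `S₁` and `t = 0` with `S₁`; that is the first case of the formula.
The subspaces of each type are counted by `ncard_submodule_inf`, which double counts families that
build `V` from `V ∩ S_u` outwards. -/

/-! ### Families generating a subspace with prescribed intersection -/

section AdaptedFamilies

variable {F : Type*} [Field F] {E : Type*} [AddCommGroup E] [Module F E]

/-- Families independent modulo `W` are an independent family of the quotient together with an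
arbitrary choice of representatives. -/
noncomputable def linearIndependentMkQEquiv (W : Submodule F E) (e : ℕ) :
    {s : Fin e → E // LinearIndependent F (W.mkQ ∘ s)} ≃
      {s : Fin e → E ⧸ W // LinearIndependent F s} × (Fin e → W) where
  toFun s := (⟨W.mkQ ∘ s.1, s.2⟩, fun i => ⟨s.1 i - (W.mkQ (s.1 i)).out, by
    rw [← Submodule.Quotient.mk_eq_zero, Submodule.Quotient.mk_sub, sub_eq_zero]
    exact (Quotient.out_eq _).symm⟩)
  invFun p := ⟨fun i => (p.1.1 i).out + p.2 i, by
    have : W.mkQ ∘ (fun i => (p.1.1 i).out + (p.2 i : E)) = p.1.1 := by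
      funext i
      simp
    rw [this]
    exact p.1.2⟩
  left_inv s := by
    ext i
    simp
  right_inv p := by
    have h (i) : W.mkQ ((p.1.1 i).out + (p.2 i : E)) = p.1.1 i := by simp
    refine Prod.ext (Subtype.ext (funext fun i => h i)) (funext fun i => Subtype.ext ?_)
    simp only [h]
    abel

/-- The induced map `V / (V ∩ W) → E / W` is injective. -/
theorem linearIndependent_mkQ_comap_subtype {V W : Submodule F E} {e : ℕ} (s : Fin e → V) :
    LinearIndependent F ((W.comap V.subtype).mkQ ∘ s) ↔
      LinearIndependent F (W.mkQ ∘ (fun i => (s i : E))) := by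
  have h := LinearMap.linearIndependent_iff (v := (W.comap V.subtype).mkQ ∘ s)
    (Submodule.mapQ (W.comap V.subtype) W V.subtype le_rfl) (by
      rw [Submodule.mapQ, Submodule.ker_liftQ, LinearMap.ker_comp, Submodule.ker_mkQ]
      exact Submodule.mkQ_map_self _)
  rw [← h]
  rfl

/-- The sum of a subspace with the spans of two families. -/
def supSpan (P : Submodule F E) {t e : ℕ} (x : (Fin t → E) × (Fin e → E)) : Submodule F E :=
  P ⊔ Submodule.span F (Set.range x.1) ⊔ Submodule.span F (Set.range x.2)

/-- Families adapted to a pair of subspaces. -/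
def IsAdapted (U P : Submodule F E) {t e : ℕ} (x : (Fin t → E) × (Fin e → E)) : Prop :=
  ((∀ i, x.1 i ∈ U) ∧ LinearIndependent F x.1) ∧ LinearIndependent F ((U ⊔ P).mkQ ∘ x.2)

/-- Modular law twice: cutting with `U ⊔ P` removes the second family, which is independent modulo
`U ⊔ P`; cutting with `U` then removes `P`. -/
theorem supSpan_inf {U P : Submodule F E} (h : Disjoint U P) {t e : ℕ}
    {x : (Fin t → E) × (Fin e → E)} (hx : IsAdapted U P x) :
    supSpan P x ⊓ U = Submodule.span F (Set.range x.1) := by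
  have hsub : Submodule.span F (Set.range x.1) ≤ U :=
    Submodule.span_le.2 (Set.range_subset_iff.2 hx.1.1)
  have hd : Submodule.span F (Set.range x.2) ⊓ (U ⊔ P) = ⊥ := by
    have := Submodule.range_ker_disjoint hx.2
    rwa [Submodule.ker_mkQ, disjoint_iff] at this
  have h1 : supSpan P x ⊓ (U ⊔ P) = P ⊔ Submodule.span F (Set.range x.1) := by
    rw [supSpan, sup_inf_assoc_of_le _ (sup_le le_sup_right (hsub.trans le_sup_left)), hd,
      sup_bot_eq]
  calc supSpan P x ⊓ U = supSpan P x ⊓ (U ⊔ P) ⊓ U := by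
        rw [inf_assoc, inf_eq_right.2 (le_sup_left : U ≤ U ⊔ P)]
    _ = Submodule.span F (Set.range x.1) ⊔ P ⊓ U := by
        rw [h1, sup_comm, sup_inf_assoc_of_le _ hsub]
    _ = _ := by rw [h.symm.eq_bot, sup_bot_eq]

theorem natCard_isAdapted (U P : Submodule F E) (t e : ℕ) :
    Nat.card {x : (Fin t → E) × (Fin e → E) // IsAdapted U P x} =
      Nat.card {s : Fin t → U // LinearIndependent F s} *
        Nat.card {s : Fin e → E // LinearIndependent F ((U ⊔ P).mkQ ∘ s)} := by
  rw [← Nat.card_prod]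
  refine Nat.card_congr
    { toFun := fun x => (⟨fun i => ⟨x.1.1 i, x.2.1.1 i⟩,
        LinearIndependent.of_comp U.subtype x.2.1.2⟩, ⟨x.1.2, x.2.2⟩)
      invFun := fun p => ⟨(fun i => (p.1.1 i : E), p.2.1),
        ⟨fun i => (p.1.1 i).2, p.1.2.map' U.subtype (Submodule.ker_subtype U)⟩, p.2.2⟩
      left_inv := fun x => rfl
      right_inv := fun p => rfl }

variable [FiniteDimensional F E]

theorem finrank_supSpan {U P : Submodule F E} (h : Disjoint U P) {t e : ℕ}
    {x : (Fin t → E) × (Fin e → E)} (hx : IsAdapted U P x) :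
    Module.finrank F (supSpan P x) = Module.finrank F P + t + e := by
  have hsub : Submodule.span F (Set.range x.1) ≤ U :=
    Submodule.span_le.2 (Set.range_subset_iff.2 hx.1.1)
  have hd : Disjoint (Submodule.span F (Set.range x.2)) (U ⊔ P) := by
    simpa using Submodule.range_ker_disjoint hx.2
  have h1 := Submodule.finrank_sup_add_finrank_inf_eq P (Submodule.span F (Set.range x.1))
  have h2 := Submodule.finrank_sup_add_finrank_inf_eq (P ⊔ Submodule.span F (Set.range x.1))
    (Submodule.span F (Set.range x.2))
  rw [(h.symm.mono_right hsub).eq_bot, finrank_bot] at h1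
  rw [(hd.symm.mono_left (sup_le le_sup_right (hsub.trans le_sup_left))).eq_bot,
    finrank_bot] at h2
  rw [finrank_span_eq_card hx.1.2, Fintype.card_fin] at h1
  rw [finrank_span_eq_card (LinearIndependent.of_comp _ hx.2), Fintype.card_fin] at h2
  rw [supSpan]
  omega

theorem natCard_isAdapted_fiber {U P V : Submodule F E} (h : Disjoint U P) (hP : P ≤ V) {t e : ℕ}
    (hV : Module.finrank F V = Module.finrank F P + t + e) :
    Nat.card {x : {x : (Fin t → E) × (Fin e → E) // IsAdapted U P x} // supSpan P x.1 = V} =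
      Nat.card {s : Fin t → ↥(V ⊓ U) // LinearIndependent F s} *
        Nat.card {s : Fin e → V //
          LinearIndependent F (((U ⊔ P).comap V.subtype).mkQ ∘ s)} := by
  rw [← Nat.card_prod]
  -- The dimensions already agree, so generating `V` over `P` only requires both families to lie in
  -- `V`.
  have key (x : (Fin t → E) × (Fin e → E)) (hx : IsAdapted U P x) :
      supSpan P x = V ↔ (∀ i, x.1 i ∈ V) ∧ ∀ i, x.2 i ∈ V := by
    constructor
    · rintro rfl
      exact ⟨fun i => Submodule.mem_sup_left (Submodule.mem_sup_right
        (Submodule.subset_span (Set.mem_range_self i))), fun i =>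
        Submodule.mem_sup_right (Submodule.subset_span (Set.mem_range_self i))⟩
    · rintro ⟨h1, h2⟩
      refine Submodule.eq_of_le_of_finrank_eq ?_ (by rw [finrank_supSpan h hx, hV])
      exact sup_le (sup_le hP (Submodule.span_le.2 (Set.range_subset_iff.2 h1)))
        (Submodule.span_le.2 (Set.range_subset_iff.2 h2))
  refine Nat.card_congr
    { toFun := fun x => (⟨fun i => ⟨x.1.1.1 i, ((key _ x.1.2).1 x.2).1 i, x.1.2.1.1 i⟩,
        LinearIndependent.of_comp (V ⊓ U).subtype x.1.2.1.2⟩,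
        ⟨fun i => ⟨x.1.1.2 i, ((key _ x.1.2).1 x.2).2 i⟩,
          (linearIndependent_mkQ_comap_subtype _).2 x.1.2.2⟩)
      invFun := fun p =>
        have hp : IsAdapted U P (fun i => (p.1.1 i : E), fun i => (p.2.1 i : E)) :=
          ⟨⟨fun i => (p.1.1 i).2.2, p.1.2.map' (V ⊓ U).subtype (Submodule.ker_subtype _)⟩,
            (linearIndependent_mkQ_comap_subtype _).1 p.2.2⟩
        ⟨⟨_, hp⟩, (key _ hp).2 ⟨fun i => (p.1.1 i).2.1, fun i => (p.2.1 i).2⟩⟩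
      left_inv := fun x => rfl
      right_inv := fun p => rfl }

theorem finrank_comap_sup {U P V : Submodule F E} (h : Disjoint U P) (hP : P ≤ V) :
    Module.finrank F ((U ⊔ P).comap V.subtype) =
      Module.finrank F ↥(V ⊓ U) + Module.finrank F P := by
  have h1 : (U ⊔ P).comap V.subtype = (V ⊓ (U ⊔ P)).comap V.subtype := by
    ext x; simp
  rw [h1, LinearEquiv.finrank_eq (Submodule.comapSubtypeEquivOfLe inf_le_left), inf_comm,
    sup_comm, sup_inf_assoc_of_le _ hP, inf_comm]
  have h2 := Submodule.finrank_sup_add_finrank_inf_eq P (V ⊓ U)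
  rw [(h.symm.mono_right inf_le_right).eq_bot, finrank_bot] at h2
  omega

end AdaptedFamilies

/-! ### Counting independent families and subspaces -/

theorem gaussBinom_natCast (q n m : ℕ) :
    gaussBinom q n m = (∏ r ∈ Finset.range m, ((q : ℚ) ^ n - (q : ℚ) ^ r)) /
      ∏ r ∈ Finset.range m, ((q : ℚ) ^ m - (q : ℚ) ^ r) := by
  rw [gaussBinom, if_neg (by simp), Finset.prod_div_distrib]
  simp

theorem gaussBinom_of_neg (q : ℕ) (n : ℤ) {m : ℤ} (h : m < 0) : gaussBinom q n m = 0 :=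
  if_pos h

theorem prod_pow_sub_pow_ne_zero {q : ℕ} (hq : 2 ≤ q) (m : ℕ) :
    ∏ r ∈ Finset.range m, ((q : ℚ) ^ m - (q : ℚ) ^ r) ≠ 0 := by
  refine Finset.prod_ne_zero_iff.2 fun r hr => sub_ne_zero.2 fun h => ?_
  have := Nat.pow_right_injective hq (by exact_mod_cast h : q ^ m = q ^ r)
  exact (Finset.mem_range.1 hr).ne' this

section Counting

variable {F : Type*} [Field F] [Finite F] {E : Type*} [AddCommGroup E] [Module F E] [Finite E]

theorem natCard_linearIndependent (k : ℕ) :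
    (Nat.card {s : Fin k → E // LinearIndependent F s} : ℚ) =
      ∏ r ∈ Finset.range k,
        ((Nat.card F : ℚ) ^ Module.finrank F E - (Nat.card F : ℚ) ^ r) := by
  classical
  have := Fintype.ofFinite F
  have hq : 1 ≤ Nat.card F := Nat.card_pos
  rcases le_or_gt k (Module.finrank F E) with hk | hk
  · rw [card_linearIndependent hk, ← Nat.card_eq_fintype_card,
      Fin.prod_univ_eq_prod_range (fun r => Nat.card F ^ Module.finrank F E - Nat.card F ^ r) k,
      Nat.cast_prod]
    refine Finset.prod_congr rfl fun r hr => ?_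
    rw [Nat.cast_sub (Nat.pow_le_pow_right hq ((Finset.mem_range.1 hr).le.trans hk))]
    push_cast
    rfl
  · have : IsEmpty {s : Fin k → E // LinearIndependent F s} := by
      refine ⟨fun s => ?_⟩
      have := s.2.fintype_card_le_finrank
      rw [Fintype.card_fin] at this
      omega
    rw [Nat.card_of_isEmpty, Nat.cast_zero, eq_comm]
    -- The factor `r = finrank F E` vanishes, so the formula also holds for families that are too
    -- long.
    exact Finset.prod_eq_zero (Finset.mem_range.2 hk) (sub_self _)

theorem natCard_linearIndependent_mkQ (W : Submodule F E) (e : ℕ) :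
    (Nat.card {s : Fin e → E // LinearIndependent F (W.mkQ ∘ s)} : ℚ) =
      ((Nat.card F : ℚ) ^ Module.finrank F W) ^ e * ∏ r ∈ Finset.range e,
        ((Nat.card F : ℚ) ^ (Module.finrank F E - Module.finrank F W) - (Nat.card F : ℚ) ^ r) := by
  have : Finite (E ⧸ W) := Finite.of_surjective _ W.mkQ_surjective
  rw [Nat.card_congr (linearIndependentMkQEquiv W e), Nat.card_prod, Nat.cast_mul,
    natCard_linearIndependent, mul_comm, Submodule.finrank_quotient, Nat.card_fun,
    Module.natCard_eq_pow_finrank (K := F) (V := W), Nat.card_fin]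
  push_cast
  rfl

/-- Adapted pairs are counted twice: directly, and fibred over the subspace they generate with `P`.
All fibres have the same size. -/
theorem ncard_submodule_mul {U P : Submodule F E} (h : Disjoint U P) (t e : ℕ) :
    (Set.ncard {V : Submodule F E | P ≤ V ∧
        Module.finrank F V = Module.finrank F P + t + e ∧ Module.finrank F ↥(V ⊓ U) = t} : ℚ) *
      ((∏ r ∈ Finset.range t, ((Nat.card F : ℚ) ^ t - (Nat.card F : ℚ) ^ r)) *
        (((Nat.card F : ℚ) ^ (t + Module.finrank F P)) ^ e *
          ∏ r ∈ Finset.range e, ((Nat.card F : ℚ) ^ e - (Nat.card F : ℚ) ^ r))) =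
      (∏ r ∈ Finset.range t,
        ((Nat.card F : ℚ) ^ Module.finrank F U - (Nat.card F : ℚ) ^ r)) *
      (((Nat.card F : ℚ) ^ (Module.finrank F U + Module.finrank F P)) ^ e *
        ∏ r ∈ Finset.range e, ((Nat.card F : ℚ) ^
          (Module.finrank F E - (Module.finrank F U + Module.finrank F P)) -
            (Nat.card F : ℚ) ^ r)) := by
  classical
  set Y := {V : Submodule F E | P ≤ V ∧
        Module.finrank F V = Module.finrank F P + t + e ∧ Module.finrank F ↥(V ⊓ U) = t} with hY
  have : Finite (Submodule F E) := Finite.of_injective _ SetLike.coe_injective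
  have : Fintype Y := Fintype.ofFinite _
  have hUP : Module.finrank F ↥(U ⊔ P) = Module.finrank F U + Module.finrank F P := by
    have h2 := Submodule.finrank_sup_add_finrank_inf_eq U P
    rw [h.eq_bot, finrank_bot] at h2
    omega
  have hX := congrArg (Nat.cast : ℕ → ℚ) (natCard_isAdapted U P t e)
  rw [Nat.cast_mul, natCard_linearIndependent, natCard_linearIndependent_mkQ, hUP] at hX
  rw [← hX]
  let f : {x : (Fin t → E) × (Fin e → E) // IsAdapted U P x} → Y := fun x =>
    ⟨supSpan P x.1, le_sup_left.trans le_sup_left, finrank_supSpan h x.2, by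
      rw [supSpan_inf h x.2, finrank_span_eq_card x.2.1.2, Fintype.card_fin]⟩
  rw [← Nat.card_congr (Equiv.sigmaFiberEquiv f), Nat.card_sigma, Nat.cast_sum]
  rw [Finset.sum_congr rfl (g := fun _ =>
    ((∏ r ∈ Finset.range t, ((Nat.card F : ℚ) ^ t - (Nat.card F : ℚ) ^ r)) *
        (((Nat.card F : ℚ) ^ (t + Module.finrank F P)) ^ e *
          ∏ r ∈ Finset.range e, ((Nat.card F : ℚ) ^ e - (Nat.card F : ℚ) ^ r))))]
  · rw [Finset.sum_const, nsmul_eq_mul, Finset.card_univ, ← Nat.card_eq_fintype_card,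
      Nat.card_coe_set_eq]
  · rintro ⟨V, hPV, hV, hVU⟩ -
    have hc : Nat.card {x // f x = ⟨V, hPV, hV, hVU⟩} =
        Nat.card {s : Fin t → ↥(V ⊓ U) // LinearIndependent F s} *
          Nat.card {s : Fin e → V //
            LinearIndependent F (((U ⊔ P).comap V.subtype).mkQ ∘ s)} := by
      rw [← natCard_isAdapted_fiber h hPV hV]
      exact Nat.card_congr (Equiv.subtypeEquivRight fun x => Subtype.ext_iff)
    rw [hc, Nat.cast_mul, natCard_linearIndependent, natCard_linearIndependent_mkQ,
      finrank_comap_sup h hPV, hVU, hV]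
    congr 5
    ext r
    congr 2
    omega

/-- The number of subspaces of dimension `d` containing `P` and meeting `U` in dimension `t`. -/
theorem ncard_submodule_inf {U P : Submodule F E} (h : Disjoint U P) (d t : ℕ) :
    (Set.ncard {V : Submodule F E | P ≤ V ∧
        Module.finrank F V = d ∧ Module.finrank F ↥(V ⊓ U) = t} : ℚ) =
      (Nat.card F : ℚ) ^ (((Module.finrank F U : ℤ) - t) * ((d : ℤ) - t - Module.finrank F P)) *
        gaussBinom (Nat.card F) (Module.finrank F U) t *
        gaussBinom (Nat.card F)
          ((Module.finrank F E : ℤ) - Module.finrank F U - Module.finrank F P)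
          ((d : ℤ) - t - Module.finrank F P) := by
  have hq : 2 ≤ Nat.card F := Finite.one_lt_card
  have hq0 : (Nat.card F : ℚ) ≠ 0 := by positivity
  have hle : Module.finrank F U + Module.finrank F P ≤ Module.finrank F E := by
    have h2 := Submodule.finrank_sup_add_finrank_inf_eq U P
    rw [h.eq_bot, finrank_bot, add_zero] at h2
    exact h2 ▸ Submodule.finrank_le _
  rcases lt_or_ge d (Module.finrank F P + t) with hd | hd
  -- Here the lower index is negative, and no such `V` exists: `V ∩ (U ⊔ P)` alone would have
  -- dimension `t + finrank F P > d`.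
  · rw [gaussBinom_of_neg (m := (d : ℤ) - t - Module.finrank F P) _ _ (by omega), mul_zero,
      Nat.cast_eq_zero]
    convert Set.ncard_empty (Submodule F E)
    refine Set.eq_empty_of_forall_notMem fun V ⟨hP, hV, hVU⟩ => ?_
    have h1 := finrank_comap_sup h hP
    have h2 := Submodule.finrank_le ((U ⊔ P).comap V.subtype)
    omega
  · obtain ⟨e, rfl⟩ := Nat.exists_eq_add_of_le hd
    have key := ncard_submodule_mul h t e
    rw [show ((Module.finrank F P + t + e : ℕ) : ℤ) - t - Module.finrank F P = (e : ℕ) by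
        push_cast; ring,
      show (Module.finrank F E : ℤ) - Module.finrank F U - Module.finrank F P =
        ((Module.finrank F E - (Module.finrank F U + Module.finrank F P) : ℕ) : ℤ) by omega,
      gaussBinom_natCast, gaussBinom_natCast]
    have h1 := prod_pow_sub_pow_ne_zero hq t
    have h2 := prod_pow_sub_pow_ne_zero hq e
    have h3 : ((Nat.card F : ℚ) ^ (Module.finrank F U + Module.finrank F P)) ^ e =
      (Nat.card F : ℚ) ^ (((Module.finrank F U : ℤ) - t) * e) *
        ((Nat.card F : ℚ) ^ (t + Module.finrank F P)) ^ e := by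
      rw [← pow_mul, ← pow_mul, ← zpow_natCast, ← zpow_natCast, ← zpow_add₀ hq0]
      congr 1
      push_cast
      ring
    rw [h3] at key
    have h4 : ((Nat.card F : ℚ) ^ (t + Module.finrank F P)) ^ e ≠ 0 := by positivity
    generalize (∏ r ∈ Finset.range t, ((Nat.card F : ℚ) ^ t - (Nat.card F : ℚ) ^ r)) = a at *
    generalize (∏ r ∈ Finset.range e, ((Nat.card F : ℚ) ^ e - (Nat.card F : ℚ) ^ r)) = b at *
    generalize ((Nat.card F : ℚ) ^ (t + Module.finrank F P)) ^ e = c at *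
    rw [← mul_left_inj' (mul_ne_zero h1 (mul_ne_zero h4 h2)), key]
    field_simp

end Counting

/-! ### Linear maps with a given kernel -/

section Kernels

variable {F : Type*} [Field F] {E : Type*} [AddCommGroup E] [Module F E] [FiniteDimensional F E]
  {L : Type*} [AddCommGroup L] [Module F L]

/-- Linear maps with prescribed kernel `V` correspond to independent families indexed by a basis
of the quotient by `V`. -/
noncomputable def kerEqEquiv (V : Submodule F E) :
    {f : E →ₗ[F] L // LinearMap.ker f = V} ≃
      {s : Fin (Module.finrank F (E ⧸ V)) → L // LinearIndependent F s} where
  toFun f := ⟨V.liftQ f.1 f.2.ge ∘ Module.finBasis F (E ⧸ V),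
    (Module.finBasis F (E ⧸ V)).linearIndependent.map' _ (by
      rw [Submodule.ker_liftQ, f.2]
      exact Submodule.mkQ_map_self _)⟩
  invFun s := ⟨(Module.finBasis F (E ⧸ V)).constr F s.1 ∘ₗ V.mkQ, by
    have : LinearMap.ker ((Module.finBasis F (E ⧸ V)).constr F s.1) = ⊥ := by
      refine LinearMap.ker_eq_bot'.2 fun x hx => ?_
      rw [Module.Basis.constr_apply_fintype] at hx
      refine (Module.finBasis F (E ⧸ V)).ext_elem fun i => ?_
      simpa using Fintype.linearIndependent_iff.1 s.2 _ hx i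
    rw [LinearMap.ker_comp, this, Submodule.comap_bot, Submodule.ker_mkQ]⟩
  left_inv f := by
    ext x
    have : (Module.finBasis F (E ⧸ V)).constr F (V.liftQ f.1 f.2.ge ∘ Module.finBasis F (E ⧸ V)) =
        V.liftQ f.1 f.2.ge := Module.Basis.ext (Module.finBasis F (E ⧸ V)) fun i => by
      rw [Module.Basis.constr_basis]
      rfl
    simp [this]
  right_inv s := by
    ext i
    have : V.liftQ ((Module.finBasis F (E ⧸ V)).constr F s.1 ∘ₗ V.mkQ)
        (by rw [LinearMap.ker_comp]; exact fun x hx => by simp [(Submodule.Quotient.mk_eq_zero V).2 hx])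
          = (Module.finBasis F (E ⧸ V)).constr F s.1 := by
      ext x
      rfl
    simp [this]

theorem natCard_ker_eq [Finite F] [Finite L] (V : Submodule F E) :
    (Nat.card {f : E →ₗ[F] L // LinearMap.ker f = V} : ℚ) =
      ∏ r ∈ Finset.range (Module.finrank F E - Module.finrank F V),
        ((Nat.card F : ℚ) ^ Module.finrank F L - (Nat.card F : ℚ) ^ r) := by
  rw [Nat.card_congr (kerEqEquiv V), natCard_linearIndependent, Submodule.finrank_quotient]

end Kernels

/-! ### Codewords as functionals, subcodes as subspaces -/

section Codes

variable {F : Type*} [Field F] (L : Type*) [Field L] [Algebra F L] {k n : ℕ}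

/-- Evaluation of `L`-valued functionals at the columns of a matrix. -/
def colEval (G : Matrix (Fin k) (Fin n) F) : ((Fin k → F) →ₗ[F] L) →ₗ[L] (Fin n → L) where
  toFun f s := f (G.col s)
  map_add' _ _ := rfl
  map_smul' _ _ := rfl

/-- The coordinate functionals span `Hom_F(F^k, L)` over `L`, and their evaluations are the rows. -/
theorem liftedCode_eq_range (G : Matrix (Fin k) (Fin n) F) :
    liftedCode L G = LinearMap.range (colEval L G) := by
  have hrow (i : Fin k) : (G.map (algebraMap F L)).row i =
      colEval L G (Algebra.linearMap F L ∘ₗ LinearMap.proj i) := rfl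
  refine le_antisymm (Submodule.span_le.2 ?_) ?_
  · rintro _ ⟨i, rfl⟩
    exact ⟨_, (hrow i).symm⟩
  · rintro _ ⟨f, rfl⟩
    have : f = ∑ i, f (Pi.single i 1) • (Algebra.linearMap F L ∘ₗ LinearMap.proj i) := by
      ext x
      simp [Pi.single_apply]
    rw [this, map_sum]
    refine Submodule.sum_mem _ fun i _ => ?_
    rw [map_smul, ← hrow]
    exact Submodule.smul_mem _ _ (Submodule.subset_span ⟨i, rfl⟩)

theorem rowCode_eq_range (G : Matrix (Fin k) (Fin n) F) :
    rowCode G = LinearMap.range (colEval F G) := by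
  rw [← liftedCode_eq_range, liftedCode]
  rfl

variable {L}

theorem hammingNorm_colEval [DecidableEq L] (G : Matrix (Fin k) (Fin n) F)
    (f : (Fin k → F) →ₗ[F] L) :
    hammingNorm (colEval L G f) + Set.ncard {s : Fin n | G.col s ∈ LinearMap.ker f} = n := by
  classical
  have h1 : {s : Fin n | G.col s ∈ LinearMap.ker f} =
      ((Finset.univ.filter fun s => f (G.col s) = 0 : Finset (Fin n)) : Set (Fin n)) := by
    ext; simp
  rw [h1, Set.ncard_coe_finset, hammingNorm, add_comm]
  exact (Finset.card_filter_add_card_filter_not _).trans (Finset.card_fin n)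

theorem weightCount_zero {K : Type*} [Field K] (C : Submodule K (Fin n → K)) :
    weightCount C 0 = 1 := by
  rw [weightCount, ← Set.ncard_singleton (0 : Fin n → K)]
  congr 1
  ext c
  simp only [hammingNorm_eq_zero, Set.mem_ofPred_eq, Set.mem_singleton_iff]
  exact ⟨fun h => h.2, fun h => ⟨h ▸ C.zero_mem, h⟩⟩

/-- By injectivity words can be counted as functionals; these are sorted by kernel, and the kernels
by codimension `j`. -/
theorem weightCount_liftedCode [Finite F] [Finite L] (G : Matrix (Fin k) (Fin n) F)
    (hinj : Function.Injective (colEval L G)) {i : ℕ} (hi : i ≤ n) :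
    (weightCount (liftedCode L G) i : ℚ) = ∑ j ∈ Finset.range (k + 1),
      (subspaceCount G (k - j) (n - i) : ℚ) * ∏ r ∈ Finset.range j,
        ((Nat.card F : ℚ) ^ Module.finrank F L - (Nat.card F : ℚ) ^ r) := by
  classical
  have : Finite (Submodule F (Fin k → F)) := Finite.of_injective _ SetLike.coe_injective
  have : Finite ((Fin k → F) →ₗ[F] L) := Finite.of_injective _ DFunLike.coe_injective
  have := Fintype.ofFinite (Submodule F (Fin k → F))
  have := Fintype.ofFinite ((Fin k → F) →ₗ[F] L)
  have h1 : weightCount (liftedCode L G) i = (Finset.univ.filter fun f : (Fin k → F) →ₗ[F] L =>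
      Set.ncard {s : Fin n | G.col s ∈ LinearMap.ker f} = n - i).card := by
    rw [weightCount, ← Set.ncard_coe_finset, ← Set.ncard_image_of_injective _ hinj]
    congr 1
    ext c
    rw [liftedCode_eq_range]
    simp only [Set.mem_ofPred_eq, Finset.coe_filter, Finset.mem_univ, true_and, Set.mem_image]
    constructor
    · rintro ⟨⟨f, rfl⟩, h⟩
      refine ⟨f, ?_, rfl⟩
      have := hammingNorm_colEval G f
      have h' : hammingNorm (colEval L G f) = i := by convert h
      omega
    · rintro ⟨f, h, rfl⟩
      refine ⟨⟨f, rfl⟩, ?_⟩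
      have := hammingNorm_colEval G f
      have h' : hammingNorm (colEval L G f) = i := by omega
      convert h'
  set T := Finset.univ.filter fun V : Submodule F (Fin k → F) =>
    Set.ncard {s : Fin n | G.col s ∈ V} = n - i with hT
  have h2 : ((Finset.univ.filter fun f : (Fin k → F) →ₗ[F] L =>
      Set.ncard {s : Fin n | G.col s ∈ LinearMap.ker f} = n - i).card : ℚ) =
      ∑ V ∈ T, ∏ r ∈ Finset.range (k - Module.finrank F V),
        ((Nat.card F : ℚ) ^ Module.finrank F L - (Nat.card F : ℚ) ^ r) := by
    rw [Finset.card_eq_sum_card_fiberwise (f := fun f => LinearMap.ker f) (t := T)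
      (fun f hf => by simpa [hT] using hf), Nat.cast_sum]
    refine Finset.sum_congr rfl fun V hV => ?_
    have h3 := natCard_ker_eq (L := L) V
    rw [Module.finrank_fin_fun] at h3
    rw [← h3, Nat.card_eq_fintype_card, Fintype.card_subtype, Finset.filter_filter]
    congr 2
    ext f
    simp only [Finset.mem_filter, Finset.mem_univ, true_and, and_iff_right_iff_imp]
    rintro rfl
    exact (Finset.mem_filter.1 hV).2
  rw [h1, h2, ← Finset.sum_fiberwise_of_maps_to (s := T) (t := Finset.range (k + 1))
    (g := fun V => k - Module.finrank F V)
    (fun V _ => Finset.mem_range.2 (Nat.lt_succ_of_le (Nat.sub_le _ _)))]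
  refine Finset.sum_congr rfl fun j hj => ?_
  rw [Finset.sum_congr rfl fun V hV => by rw [(Finset.mem_filter.1 hV).2], Finset.sum_const,
    nsmul_eq_mul]
  congr 2
  rw [subspaceCount, ← Set.ncard_coe_finset]
  congr 1
  ext V
  have := Submodule.finrank_le V
  rw [Module.finrank_fin_fun] at this
  have hj' := Finset.mem_range.1 hj
  simp only [hT, Finset.coe_filter, Finset.mem_filter, Finset.mem_univ, true_and,
    Set.mem_ofPred_eq, and_comm (a := _ = n - i)]
  exact and_congr_left fun _ => by omega

/-- The bijection sends `V` to the evaluations of its annihilator. A coordinate vanishes on that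
subcode exactly when its column lies in the double annihilator, which is `V`. -/
theorem subcodeCount_rowCode (G : Matrix (Fin k) (Fin n) F)
    (hinj : Function.Injective (colEval F G)) {i j : ℕ} (hi : i ≤ n) (hj : j ≤ k) :
    subcodeCount (rowCode G) j i = subspaceCount G (k - j) (n - i) := by
  have hmap : Function.Injective (Submodule.map (colEval F G)) :=
    Submodule.map_injective_of_injective hinj
  have hψ : Function.Injective fun V : Submodule F (Fin k → F) =>
      Submodule.map (colEval F G) V.dualAnnihilator :=
    fun V W h => Subspace.dualAnnihilator_inj.1 (hmap h)
  have hfin (V : Submodule F (Fin k → F)) : Module.finrank F V +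
      Module.finrank F (Submodule.map (colEval F G) V.dualAnnihilator) = k := by
    rw [← (Submodule.equivMapOfInjective _ hinj _).finrank_eq]
    exact (Subspace.finrank_add_finrank_dualAnnihilator_eq V).trans (Module.finrank_fin_fun F)
  have hsupp (V : Submodule F (Fin k → F)) :
      supportWeight (Submodule.map (colEval F G) V.dualAnnihilator) +
        Set.ncard {s : Fin n | G.col s ∈ V} = n := by
    have : {s : Fin n | ∃ c ∈ Submodule.map (colEval F G) V.dualAnnihilator, c s ≠ 0} =
        {s : Fin n | G.col s ∈ V}ᶜ := by
      ext s
      rw [Set.mem_compl_iff, Set.mem_ofPred_eq, Set.mem_ofPred_eq,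
        ← Subspace.dualAnnihilator_dualCoannihilator_eq (W := V), Submodule.mem_dualCoannihilator]
      push Not
      constructor
      · rintro ⟨_, ⟨f, hf, rfl⟩, h⟩
        exact ⟨f, by simpa using hf, h⟩
      · rintro ⟨f, hf, h⟩
        exact ⟨_, ⟨f, by simpa using hf, rfl⟩, h⟩
    rw [supportWeight, this, add_comm, Set.ncard_add_ncard_compl, Nat.card_fin]
  rw [subspaceCount, ← Set.ncard_image_of_injective _ hψ, subcodeCount, rowCode_eq_range]
  congr 1
  ext D
  simp only [Set.mem_ofPred_eq, Set.mem_image]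
  constructor
  · rintro ⟨hD, hd, hw⟩
    have hV : Submodule.map (colEval F G)
        (Submodule.dualCoannihilator (D.comap (colEval F G))).dualAnnihilator = D := by
      rw [Subspace.dualCoannihilator_dualAnnihilator_eq, Submodule.map_comap_eq, inf_eq_right.2 hD]
    refine ⟨_, ⟨?_, ?_⟩, hV⟩
    · have := hfin (Submodule.dualCoannihilator (D.comap (colEval F G)))
      rw [hV] at this
      omega
    · have := hsupp (Submodule.dualCoannihilator (D.comap (colEval F G)))
      rw [hV] at this
      omega
  · rintro ⟨V, ⟨hd, hc⟩, rfl⟩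
    have h1 := hfin V
    have h2 := hsupp V
    exact ⟨LinearMap.map_le_range, by omega, by omega⟩

end Codes

/-! ### The `q`-Pascal rule and coincidences between powers of `q` -/

section GaussianBinomials

theorem gaussBinom_one (q n : ℕ) : gaussBinom q n 1 = ((q : ℚ) ^ n - 1) / ((q : ℚ) - 1) := by
  have := gaussBinom_natCast q n 1
  simpa using this

theorem gaussBinom_zero (q : ℕ) (n : ℤ) : gaussBinom q n 0 = 1 := by
  simp [gaussBinom]

theorem prod_pow_succ_sub_pow (x : ℚ) (n a : ℕ) :
    ∏ r ∈ Finset.range (a + 1), (x ^ (n + 1) - x ^ r) =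
      (x ^ (n + 1) - 1) * x ^ a * ∏ r ∈ Finset.range a, (x ^ n - x ^ r) := by
  rw [Finset.prod_range_succ', pow_zero, mul_comm, mul_assoc]
  congr 1
  rw [Finset.prod_congr rfl (g := fun r => x * (x ^ n - x ^ r)) fun r _ => by ring,
    Finset.prod_mul_distrib, Finset.prod_const, Finset.card_range]

theorem gaussBinom_succ {q : ℕ} (hq : 2 ≤ q) (n : ℕ) (m : ℤ) :
    gaussBinom q (n + 1) m = (q : ℚ) ^ m * gaussBinom q n m + gaussBinom q n (m - 1) := by
  rcases lt_trichotomy m 0 with hm | rfl | hm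
  · simp [gaussBinom_of_neg _ _ hm, gaussBinom_of_neg _ _ (show m - 1 < 0 by omega)]
  · rw [gaussBinom_zero, gaussBinom_zero, gaussBinom_of_neg _ _ (by omega)]
    simp
  · obtain ⟨a, rfl⟩ : ∃ a : ℕ, m = a + 1 := ⟨(m - 1).toNat, by omega⟩
    have h1 := gaussBinom_natCast q (n + 1) (a + 1)
    have h2 := gaussBinom_natCast q n (a + 1)
    push_cast at h1 h2
    have hq0 : (q : ℚ) ≠ 0 := by positivity
    have h0 : (q : ℚ) ^ (a + 1) - 1 ≠ 0 :=
      sub_ne_zero.2 (one_lt_pow₀ (by exact_mod_cast hq) (by omega)).ne'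
    rw [h1, h2, add_sub_cancel_right, gaussBinom_natCast, prod_pow_succ_sub_pow,
      prod_pow_succ_sub_pow, Finset.prod_range_succ]
    have h3 := prod_pow_sub_pow_ne_zero hq a
    rw [show (q : ℚ) ^ ((a : ℤ) + 1) = (q : ℚ) ^ (a + 1) by exact_mod_cast zpow_natCast (q : ℚ) (a + 1)]
    field_simp
    ring

/-- For `t > 0`, reduction modulo `q` would give `q ∣ 1`. This isolates the only coincidence between
column counts of subspaces with and without `S₁`. -/
theorem eq_of_pow_add_eq_pow {q s t : ℕ} (hq : 2 ≤ q)
    (h : (q : ℤ) ^ t + q - 1 = (q : ℤ) ^ s) : t = 0 ∧ s = 1 := by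
  have hs : s ≠ 0 := by
    rintro rfl
    have : (0 : ℤ) < (q : ℤ) ^ t := by positivity
    rw [pow_zero] at h
    omega
  have ht : t = 0 := by
    by_contra ht
    have h1 : (q : ℤ) ∣ 1 := by
      have h2 := dvd_pow_self (q : ℤ) ht
      have h3 := dvd_pow_self (q : ℤ) hs
      have h4 := dvd_sub (dvd_add h2 (dvd_refl _)) h3
      rwa [show (q : ℤ) ^ t + q - (q : ℤ) ^ s = 1 by omega] at h4
    have := Int.le_of_dvd one_pos h1
    omega
  subst ht
  refine ⟨rfl, ?_⟩
  have h1 : q ^ 1 = q ^ s := by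
    zify
    rw [← h]
    ring
  exact (Nat.pow_right_injective hq h1).symm

theorem pow_right_injective_int {q s t : ℕ} (hq : 2 ≤ q) (h : (q : ℤ) ^ t = (q : ℤ) ^ s) :
    t = s :=
  Nat.pow_right_injective hq (by exact_mod_cast h : q ^ t = q ^ s)

end GaussianBinomials

/-! ### Columns in a subspace, and spanning -/

section ColumnCounts

theorem ncard_submodule_coe {F : Type*} [Field F] {E : Type*} [AddCommGroup E] [Module F E] [FiniteDimensional F E]
    (W : Submodule F E) : Set.ncard (W : Set E) = Nat.card F ^ Module.finrank F W := by
  rw [← Nat.card_coe_set_eq]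
  exact Module.natCard_eq_pow_finrank (K := F) (V := W)

theorem finrank_lt_of_disjoint {F : Type*} [Field F] {k : ℕ} {S₁ S_u : Submodule F (Fin k → F)}
    (hS₁ : Module.finrank F S₁ = 1) (hd : Disjoint S_u S₁) :
    Module.finrank F S_u + 1 ≤ k := by
  have h2 := Submodule.finrank_sup_add_finrank_inf_eq S_u S₁
  rw [hd.eq_bot, finrank_bot, hS₁] at h2
  have h3 := Submodule.finrank_le (S_u ⊔ S₁)
  rw [Module.finrank_fin_fun] at h3
  omega

variable {F : Type*} [Field F] [Finite F] {k n : ℕ} {S₁ S_u : Submodule F (Fin k → F)}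
  {G : Matrix (Fin k) (Fin n) F}

open Classical in
-- Inclusion–exclusion: `V ∩ S_u` and `V ∩ S₁` share only zero, and the line `S₁` lies in `V` or
-- meets it trivially.
theorem ncard_col_mem (hS₁ : Module.finrank F S₁ = 1) (hd : Disjoint S_u S₁)
    (hG : IsColumnMatrix G (Set.univ \ ((S_u : Set (Fin k → F)) ∪ (S₁ : Set (Fin k → F)))))
    (V : Submodule F (Fin k → F)) :
    (Set.ncard {s : Fin n | G.col s ∈ V} : ℤ) = (Nat.card F : ℤ) ^ Module.finrank F V -
      (Nat.card F : ℤ) ^ Module.finrank F ↥(V ⊓ S_u) -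
        if S₁ ≤ V then (Nat.card F : ℤ) - 1 else 0 := by
  have h1 : Set.ncard {s : Fin n | G.col s ∈ V} =
      Set.ncard ((V : Set (Fin k → F)) \ ((S_u : Set (Fin k → F)) ∪ S₁)) := by
    rw [← Set.ncard_image_of_injective _ hG.1]
    congr 1
    ext x
    constructor
    · rintro ⟨s, hs, rfl⟩
      exact ⟨hs, (hG.2.subset ⟨s, rfl⟩).2⟩
    · rintro ⟨hx, hx'⟩
      obtain ⟨s, rfl⟩ := hG.2.superset ⟨Set.mem_univ x, hx'⟩
      exact ⟨s, hx, rfl⟩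
  have h2 := Set.ncard_inter_add_ncard_sdiff_eq_ncard (V : Set (Fin k → F))
    ((S_u : Set (Fin k → F)) ∪ S₁) (Set.toFinite _)
  have h3 := Set.ncard_union_add_ncard_inter (↑(V ⊓ S_u) : Set (Fin k → F))
    (↑(V ⊓ S₁) : Set (Fin k → F)) (Set.toFinite _) (Set.toFinite _)
  have h4 : (↑(V ⊓ S_u) : Set (Fin k → F)) ∩ (↑(V ⊓ S₁) : Set (Fin k → F)) =
      ((⊥ : Submodule F (Fin k → F)) : Set (Fin k → F)) := by
    rw [← Submodule.coe_inf, (hd.mono inf_le_right inf_le_right).eq_bot]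
  have h5 : (↑(V ⊓ S_u) : Set (Fin k → F)) ∪ (↑(V ⊓ S₁) : Set (Fin k → F)) =
      (V : Set (Fin k → F)) ∩ ((S_u : Set (Fin k → F)) ∪ S₁) := by
    rw [Set.inter_union_distrib_left]
    rfl
  rw [h4, h5, ncard_submodule_coe, ncard_submodule_coe, ncard_submodule_coe, finrank_bot] at h3
  rw [ncard_submodule_coe] at h2
  rw [h1]
  split_ifs with h
  · rw [inf_eq_right.2 h, hS₁] at h3
    zify at h2 h3
    rw [pow_one] at h3
    linarith
  · have h6 : Module.finrank F ↥(V ⊓ S₁) = 0 := by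
      by_contra h0
      refine h (inf_eq_right.1 (Submodule.eq_of_le_of_finrank_le inf_le_right ?_))
      omega
    rw [h6] at h3
    zify at h2 h3
    linarith

theorem length_eq (hS₁ : Module.finrank F S₁ = 1) (hd : Disjoint S_u S₁)
    (hG : IsColumnMatrix G (Set.univ \ ((S_u : Set (Fin k → F)) ∪ (S₁ : Set (Fin k → F))))) :
    (n : ℤ) = (Nat.card F : ℤ) ^ k - (Nat.card F : ℤ) ^ Module.finrank F S_u -
      (Nat.card F : ℤ) + 1 := by
  have h := ncard_col_mem hS₁ hd hG ⊤
  rw [top_inf_eq, finrank_top, Module.finrank_fin_fun, if_pos le_top] at h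
  simp only [Submodule.mem_top, Set.ofPred_true, Set.ncard_univ, Nat.card_fin] at h
  linarith

/-- Says that no hyperplane contains all columns. Equality would make `(q - 1) * c + ε` zero, with
`c = q^(k-1) - 1 > 0` if `t = u`, and `c = q^(k-1) - q^t - 1 ≥ 0` if `t + 1 = u`; the latter
vanishes only in the excluded case. -/
theorem hyperplane_count_ne {q k u t : ℕ} (hq : 2 ≤ q) (hk : 2 ≤ k) (hu : u + 1 ≤ k)
    (hexc : ¬(q = 2 ∧ k = 2 ∧ u = 1)) (ht : t = u ∨ t + 1 = u) {ε : ℤ} (hε : ε = q - 1 ∨ ε = 0) :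
    (q : ℤ) ^ (k - 1) - (q : ℤ) ^ t - ε ≠ (q : ℤ) ^ k - (q : ℤ) ^ u - q + 1 := by
  intro h
  obtain ⟨k, rfl⟩ := Nat.exists_eq_add_of_le' hk
  have e1 : (q : ℤ) ^ (k + 2 - 1) = q * (q : ℤ) ^ k := by
    rw [show k + 2 - 1 = k + 1 by omega, pow_succ']
  have e2 : (q : ℤ) ^ (k + 2) = q * (q * (q : ℤ) ^ k) := by ring
  have hq' : (2 : ℤ) ≤ q := by exact_mod_cast hq
  have hQ : (1 : ℤ) ≤ (q : ℤ) ^ k := one_le_pow₀ (by omega)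
  rw [e1, e2] at h
  have hε0 : 0 ≤ ε := by omega
  rcases ht with rfl | rfl
  · have h5 : ((q : ℤ) - 1) * (q * (q : ℤ) ^ k - 1) + ε = 0 := by linarith
    have h6 : 0 < ((q : ℤ) - 1) * (q * (q : ℤ) ^ k - 1) :=
      mul_pos (by omega) (by nlinarith)
    omega
  · have hT : (q : ℤ) ^ t ≤ (q : ℤ) ^ k := pow_le_pow_right₀ (by omega) (by omega)
    rw [pow_succ'] at h
    have h5 : ((q : ℤ) - 1) * (q * (q : ℤ) ^ k - (q : ℤ) ^ t - 1) + ε = 0 := by linarith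
    have h6 : (0 : ℤ) ≤ q * (q : ℤ) ^ k - (q : ℤ) ^ t - 1 := by nlinarith
    have h7 : (q : ℤ) * (q : ℤ) ^ k - (q : ℤ) ^ t - 1 = 0 := by
      have := mul_nonneg (show (0 : ℤ) ≤ q - 1 by omega) h6
      rcases mul_eq_zero.1 (show ((q : ℤ) - 1) * (q * (q : ℤ) ^ k - (q : ℤ) ^ t - 1) = 0 by omega)
        with h8 | h8
      · omega
      · exact h8
    have h8 : (q : ℤ) = 2 := by
      by_contra hne
      have : (3 : ℤ) ≤ q := by omega
      nlinarith
    have h9 : (q : ℤ) ^ k = 1 := by nlinarith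
    have h10 : (q : ℤ) ^ t = 1 := by nlinarith
    have h11 : k = 0 := pow_right_injective_int hq (by rw [h9, pow_zero])
    have h12 : t = 0 := pow_right_injective_int hq (by rw [h10, pow_zero])
    exact hexc ⟨by exact_mod_cast h8, by omega, by omega⟩

theorem colEval_injective {L : Type*} [Field L] [Algebra F L]
    (hS₁ : Module.finrank F S₁ = 1) (hd : Disjoint S_u S₁)
    (hexc : ¬(Nat.card F = 2 ∧ k = 2 ∧ Module.finrank F S_u = 1))
    (hG : IsColumnMatrix G (Set.univ \ ((S_u : Set (Fin k → F)) ∪ (S₁ : Set (Fin k → F)))))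
    (hk : 2 ≤ k) : Function.Injective (colEval L G) := by
  classical
  rw [injective_iff_map_eq_zero]
  intro f hf
  rw [← LinearMap.ker_eq_top]
  by_contra hne
  -- The kernel of `f` may have any codimension; enlarging it to a hyperplane `ker g` keeps all
  -- columns inside.
  obtain ⟨g, hg0, hg⟩ := Submodule.exists_le_ker_of_lt_top _ (lt_top_iff_ne_top.2 hne)
  have hcol : {s : Fin n | G.col s ∈ LinearMap.ker g} = Set.univ :=
    Set.eq_univ_of_forall fun s => hg (congrFun hf s)
  have h1 := ncard_col_mem hS₁ hd hG (LinearMap.ker g)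
  have hker : Module.finrank F (LinearMap.ker g) = k - 1 := by
    have h2 := LinearMap.finrank_range_add_finrank_ker g
    rw [LinearMap.range_eq_top.2 (LinearMap.surjective hg0), finrank_top, Module.finrank_self,
      Module.finrank_fin_fun] at h2
    omega
  rw [hcol, Set.ncard_univ, Nat.card_fin, hker, length_eq hS₁ hd hG] at h1
  have hu := finrank_lt_of_disjoint hS₁ hd
  refine hyperplane_count_ne Finite.one_lt_card hk hu hexc ?_ ?_ h1.symm
  · have h3 := Submodule.finrank_sup_add_finrank_inf_eq (LinearMap.ker g) S_u
    have h4 := Submodule.finrank_le (LinearMap.ker g ⊔ S_u)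
    have h5 := Submodule.finrank_mono (inf_le_right : LinearMap.ker g ⊓ S_u ≤ S_u)
    rw [Module.finrank_fin_fun] at h4
    omega
  · split_ifs <;> simp

end ColumnCounts

/-! ### Subspaces with a given number of columns -/

section SubspaceCounts

variable {F : Type*} [Field F] [Finite F] {k n : ℕ} {S₁ S_u : Submodule F (Fin k → F)}
  {G : Matrix (Fin k) (Fin n) F}

/-- `ncard_submodule_inf` with `P = ⊥` minus the same count with `P = S₁`. -/
theorem ncard_submodule_avoiding (hS₁ : Module.finrank F S₁ = 1) (hd : Disjoint S_u S₁)
    (d t : ℕ) :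
    (Set.ncard {V : Submodule F (Fin k → F) | ¬ S₁ ≤ V ∧
        Module.finrank F V = d ∧ Module.finrank F ↥(V ⊓ S_u) = t} : ℚ) =
      (Nat.card F : ℚ) ^ (((Module.finrank F S_u : ℤ) - t) * ((d : ℤ) - t - 1)) *
        gaussBinom (Nat.card F) (Module.finrank F S_u) t *
        ((Nat.card F : ℚ) ^ ((Module.finrank F S_u : ℤ) - t) *
          gaussBinom (Nat.card F) ((k : ℤ) - Module.finrank F S_u) ((d : ℤ) - t) -
          gaussBinom (Nat.card F) ((k : ℤ) - Module.finrank F S_u - 1) ((d : ℤ) - t - 1)) := by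
  have h0 := ncard_submodule_inf (disjoint_bot_right (a := S_u)) d t
  have h1 := ncard_submodule_inf hd d t
  have : Finite (Submodule F (Fin k → F)) := Finite.of_injective _ SetLike.coe_injective
  have h2 := Set.ncard_inter_add_ncard_sdiff_eq_ncard {V : Submodule F (Fin k → F) | ⊥ ≤ V ∧
    Module.finrank F V = d ∧ Module.finrank F ↥(V ⊓ S_u) = t} {V | S₁ ≤ V} (Set.toFinite _)
  have e1 : {V : Submodule F (Fin k → F) | ⊥ ≤ V ∧
    Module.finrank F V = d ∧ Module.finrank F ↥(V ⊓ S_u) = t} ∩ {V | S₁ ≤ V} =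
      {V | S₁ ≤ V ∧ Module.finrank F V = d ∧ Module.finrank F ↥(V ⊓ S_u) = t} := by
    ext V
    simp [and_comm]
  have e2 : {V : Submodule F (Fin k → F) | ⊥ ≤ V ∧
    Module.finrank F V = d ∧ Module.finrank F ↥(V ⊓ S_u) = t} \ {V | S₁ ≤ V} =
      {V | ¬ S₁ ≤ V ∧ Module.finrank F V = d ∧ Module.finrank F ↥(V ⊓ S_u) = t} := by
    ext V
    simp [and_comm]
  have hq0 : (Nat.card F : ℚ) ≠ 0 := Nat.cast_ne_zero.2 Nat.card_pos.ne'
  have h3 := congrArg (Nat.cast : ℕ → ℚ) h2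
  rw [e1, e2, Nat.cast_add, h0, h1, finrank_bot, hS₁, Module.finrank_fin_fun] at h3
  rw [← eq_sub_iff_add_eq'] at h3
  rw [h3, Nat.cast_zero, sub_zero, sub_zero, Nat.cast_one,
    show ((Module.finrank F S_u : ℤ) - t) * ((d : ℤ) - t) =
      ((Module.finrank F S_u : ℤ) - t) * ((d : ℤ) - t - 1) + ((Module.finrank F S_u : ℤ) - t) by
      ring, zpow_add₀ hq0]
  ring

theorem ncard_submodule_containing (hS₁ : Module.finrank F S₁ = 1) (hd : Disjoint S_u S₁)
    (d t : ℕ) :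
    (Set.ncard {V : Submodule F (Fin k → F) | S₁ ≤ V ∧
        Module.finrank F V = d ∧ Module.finrank F ↥(V ⊓ S_u) = t} : ℚ) =
      (Nat.card F : ℚ) ^ (((Module.finrank F S_u : ℤ) - t) * ((d : ℤ) - t - 1)) *
        gaussBinom (Nat.card F) ((k : ℤ) - Module.finrank F S_u - 1) ((d : ℤ) - t - 1) *
        gaussBinom (Nat.card F) (Module.finrank F S_u) t := by
  have h1 := ncard_submodule_inf hd d t
  rw [hS₁, Module.finrank_fin_fun, Nat.cast_one] at h1
  rw [h1]
  ring

theorem subspaceCount_of_eq_pow_sub_pow (hS₁ : Module.finrank F S₁ = 1) (hd : Disjoint S_u S₁)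
    (hG : IsColumnMatrix G (Set.univ \ ((S_u : Set (Fin k → F)) ∪ (S₁ : Set (Fin k → F)))))
    {d m t : ℕ} (ht : t ≠ 1) (hm : (m : ℤ) = (Nat.card F : ℤ) ^ d - (Nat.card F : ℤ) ^ t) :
    subspaceCount G d m = Set.ncard {V : Submodule F (Fin k → F) | ¬ S₁ ≤ V ∧
        Module.finrank F V = d ∧ Module.finrank F ↥(V ⊓ S_u) = t} := by
  have hq : 2 ≤ Nat.card F := Finite.one_lt_card
  rw [subspaceCount]
  congr 1
  ext V
  have h := ncard_col_mem hS₁ hd hG V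
  constructor
  · rintro ⟨rfl, hc⟩
    rw [hc, hm] at h
    split_ifs at h with hV
    -- A subspace containing `S₁` could give this count only for `t = 1`.
    · exact absurd (eq_of_pow_add_eq_pow hq (by linarith)).2 ht
    · exact ⟨hV, rfl, pow_right_injective_int hq (by linarith)⟩
  · rintro ⟨hV, rfl, rfl⟩
    rw [if_neg hV] at h
    exact ⟨rfl, by zify; linarith⟩

theorem subspaceCount_of_eq_pow_sub_pow_sub (hS₁ : Module.finrank F S₁ = 1)
    (hd : Disjoint S_u S₁)
    (hG : IsColumnMatrix G (Set.univ \ ((S_u : Set (Fin k → F)) ∪ (S₁ : Set (Fin k → F)))))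
    {d m t : ℕ} (ht : t ≠ 0)
    (hm : (m : ℤ) = (Nat.card F : ℤ) ^ d - (Nat.card F : ℤ) ^ t - Nat.card F + 1) :
    subspaceCount G d m = Set.ncard {V : Submodule F (Fin k → F) | S₁ ≤ V ∧
        Module.finrank F V = d ∧ Module.finrank F ↥(V ⊓ S_u) = t} := by
  have hq : 2 ≤ Nat.card F := Finite.one_lt_card
  rw [subspaceCount]
  congr 1
  ext V
  have h := ncard_col_mem hS₁ hd hG V
  constructor
  · rintro ⟨rfl, hc⟩
    rw [hc, hm] at h
    split_ifs at h with hV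
    · exact ⟨hV, rfl, pow_right_injective_int hq (by linarith)⟩
    · exact absurd (eq_of_pow_add_eq_pow (t := t) hq (by linarith)).1 ht
  · rintro ⟨hV, rfl, rfl⟩
    rw [if_pos hV] at h
    exact ⟨rfl, by zify; linarith⟩

theorem subspaceCount_of_eq_pow_sub (hS₁ : Module.finrank F S₁ = 1) (hd : Disjoint S_u S₁)
    (hG : IsColumnMatrix G (Set.univ \ ((S_u : Set (Fin k → F)) ∪ (S₁ : Set (Fin k → F)))))
    {d m : ℕ} (hm : (m : ℤ) = (Nat.card F : ℤ) ^ d - Nat.card F) :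
    subspaceCount G d m =
      Set.ncard {V : Submodule F (Fin k → F) | ¬ S₁ ≤ V ∧
        Module.finrank F V = d ∧ Module.finrank F ↥(V ⊓ S_u) = 1} +
      Set.ncard {V : Submodule F (Fin k → F) | S₁ ≤ V ∧
        Module.finrank F V = d ∧ Module.finrank F ↥(V ⊓ S_u) = 0} := by
  have hq : 2 ≤ Nat.card F := Finite.one_lt_card
  have : Finite (Submodule F (Fin k → F)) := Finite.of_injective _ SetLike.coe_injective
  rw [subspaceCount, ← Set.ncard_union_eq
    (Set.disjoint_left.2 fun V h1 h2 => h1.1 h2.1) (Set.toFinite _) (Set.toFinite _)]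
  congr 1
  ext V
  have h := ncard_col_mem hS₁ hd hG V
  constructor
  · rintro ⟨rfl, hc⟩
    rw [hc, hm] at h
    split_ifs at h with hV
    · exact Or.inr ⟨hV, rfl, (eq_of_pow_add_eq_pow (s := 1) hq (by rw [pow_one]; linarith)).1⟩
    · exact Or.inl ⟨hV, rfl, pow_right_injective_int hq (by rw [pow_one]; linarith)⟩
  · rintro (⟨hV, rfl, ht⟩ | ⟨hV, rfl, ht⟩)
    · rw [if_neg hV, ht] at h
      exact ⟨rfl, by zify; linarith⟩
    · rw [if_pos hV, ht] at h
      exact ⟨rfl, by zify; linarith⟩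

theorem subspaceCount_eq_zero (hS₁ : Module.finrank F S₁ = 1) (hd : Disjoint S_u S₁)
    (hG : IsColumnMatrix G (Set.univ \ ((S_u : Set (Fin k → F)) ∪ (S₁ : Set (Fin k → F)))))
    {d m : ℕ} (h₁ : (m : ℤ) ≠ (Nat.card F : ℤ) ^ d - Nat.card F)
    (h₂ : ∀ t : ℕ, t ≠ 1 → (m : ℤ) ≠ (Nat.card F : ℤ) ^ d - (Nat.card F : ℤ) ^ t)
    (h₃ : ∀ t : ℕ, t ≠ 0 →
      (m : ℤ) ≠ (Nat.card F : ℤ) ^ d - (Nat.card F : ℤ) ^ t - Nat.card F + 1) :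
    subspaceCount G d m = 0 := by
  rw [subspaceCount]
  convert Set.ncard_empty (Submodule F (Fin k → F))
  refine Set.eq_empty_of_forall_notMem fun V ⟨hV, hc⟩ => ?_
  have h := ncard_col_mem hS₁ hd hG V
  rw [hc, hV] at h
  split_ifs at h with hS
  · by_cases ht : Module.finrank F ↥(V ⊓ S_u) = 0
    · rw [ht] at h
      exact h₁ (by linarith)
    · exact h₃ _ ht (by linarith)
  · by_cases ht : Module.finrank F ↥(V ⊓ S_u) = 1
    · rw [ht] at h
      exact h₁ (by linarith)
    · exact h₂ _ ht (by linarith)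

end SubspaceCounts

/-! ### Assembling the formulas -/

/-- Adds the two coinciding types, with `D = k - j` and `N = k - u - 1`. The `q`-Pascal rule expands
the binomial with top `N + 1`, and terms are collected by lower index `D - 1` and `D - 2`. -/
theorem subspaceCount_formula_collision {q : ℕ} (hq : 2 ≤ q) (u N : ℕ) (D : ℤ) :
    (q : ℚ) ^ (((u : ℤ) - (1 : ℕ)) * (D - (1 : ℕ) - 1)) * gaussBinom q u (1 : ℕ) *
        ((q : ℚ) ^ ((u : ℤ) - (1 : ℕ)) * gaussBinom q (N + 1) (D - (1 : ℕ)) -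
          gaussBinom q N (D - (1 : ℕ) - 1)) +
      (q : ℚ) ^ (((u : ℤ) - (0 : ℕ)) * (D - (0 : ℕ) - 1)) *
        gaussBinom q N (D - (0 : ℕ) - 1) * gaussBinom q u (0 : ℕ) =
      (q : ℚ) ^ ((u : ℤ) * (D - 1)) * (gaussBinom q u 1 + 1) * gaussBinom q N (D - 1) +
        (q : ℚ) ^ (((u : ℤ) - 1) * (D - 2)) *
          (((q : ℚ) ^ u - 1) * ((q : ℚ) ^ ((u : ℤ) - 1) - 1) / ((q : ℚ) - 1)) *
          gaussBinom q N (D - 2) := by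
  have hq0 : (q : ℚ) ≠ 0 := by positivity
  rw [Nat.cast_one, Nat.cast_zero, sub_zero, sub_zero, gaussBinom_succ hq, gaussBinom_zero,
    gaussBinom_one, show D - 1 - 1 = D - 2 by ring]
  have e : (q : ℚ) ^ ((u : ℤ) * (D - 1)) =
      (q : ℚ) ^ (((u : ℤ) - 1) * (D - 2)) * (q : ℚ) ^ ((u : ℤ) - 1) * (q : ℚ) ^ (D - 1) := by
    rw [← zpow_add₀ hq0, ← zpow_add₀ hq0]
    congr 1
    ring
  rw [e]
  ring

theorem mainTheorem5 {F L : Type*} [Field F] [Finite F] [Field L] [Algebra F L]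
    (q l k u n : ℕ) (hq : Nat.card F = q) (hl : 1 ≤ l) (hL : Module.finrank F L = l)
    (S₁ S_u : Submodule F (Fin k → F))
    (hS₁ : Module.finrank F S₁ = 1) (hS_u : Module.finrank F S_u = u)
    (hdisj : Module.finrank F ↥(S_u ⊓ S₁) = 0)
    (hexc : ¬ (q = 2 ∧ k = 2 ∧ u = 1))
    (G : Matrix (Fin k) (Fin n) F)
    (hG : IsColumnMatrix G (Set.univ \ ((S_u : Set (Fin k → F)) ∪ (S₁ : Set (Fin k → F))))) :
    ∃ A : ℕ → ℕ → ℚ,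
      (n : ℤ) = (q : ℤ) ^ k - (q : ℤ) ^ u - q + 1 ∧
      weightEnumerator (liftedCode L G) =
        1 + ∑ i ∈ Finset.Icc 1 n, ∑ j ∈ Finset.Icc 1 k,
          Polynomial.C (A i j * ∏ r ∈ Finset.range j, ((q : ℚ) ^ l - (q : ℚ) ^ r)) *
            Polynomial.X ^ i ∧
      ∀ i ∈ Finset.Icc 1 n, ∀ j ∈ Finset.Icc 1 k,
        A i j = subspaceCount G (k - j) (n - i) ∧
        A i j = subcodeCount (rowCode G) j i ∧
        ((n : ℤ) - i = (q : ℤ) ^ (k - j) - q →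
          A i j =
            (q : ℚ) ^ ((u : ℤ) * (k - j - 1)) * (gaussBinom q u 1 + 1) *
                gaussBinom q (k - u - 1) (k - j - 1) +
              (q : ℚ) ^ (((u : ℤ) - 1) * (k - j - 2)) *
                (((q : ℚ) ^ u - 1) * ((q : ℚ) ^ ((u : ℤ) - 1) - 1) / ((q : ℚ) - 1)) *
                gaussBinom q (k - u - 1) (k - j - 2)) ∧
        (∀ t : ℕ, t ≠ 1 → (n : ℤ) - i = (q : ℤ) ^ (k - j) - (q : ℤ) ^ t →
          A i j =
            (q : ℚ) ^ (((u : ℤ) - t) * (k - j - t - 1)) * gaussBinom q u t *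
              ((q : ℚ) ^ ((u : ℤ) - t) * gaussBinom q (k - u) (k - j - t) -
                gaussBinom q (k - u - 1) (k - j - t - 1))) ∧
        (∀ t : ℕ, t ≠ 0 → (n : ℤ) - i = (q : ℤ) ^ (k - j) - (q : ℤ) ^ t - q + 1 →
          A i j =
            (q : ℚ) ^ (((u : ℤ) - t) * (k - j - t - 1)) *
              gaussBinom q (k - u - 1) (k - j - t - 1) * gaussBinom q u t) ∧
        ((n : ℤ) - i ≠ (q : ℤ) ^ (k - j) - q →
          (∀ t : ℕ, t ≠ 1 → (n : ℤ) - i ≠ (q : ℤ) ^ (k - j) - (q : ℤ) ^ t) →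
          (∀ t : ℕ, t ≠ 0 → (n : ℤ) - i ≠ (q : ℤ) ^ (k - j) - (q : ℤ) ^ t - q + 1) →
          A i j = 0) := by
  subst hq hS_u hL
  have hd : Disjoint S_u S₁ := disjoint_iff.2 (Submodule.finrank_eq_zero.1 hdisj)
  have hlen := length_eq hS₁ hd hG
  have hu := finrank_lt_of_disjoint hS₁ hd
  have hcard : 2 ≤ Nat.card F := Finite.one_lt_card
  have : Module.Finite F L := Module.finite_of_finrank_pos hl
  have : Finite L := Module.finite_of_finite F
  -- For `k = 1` the line `S₁` is the whole space and there are no columns, so injectivity of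
  -- evaluation is needed only for `k ≥ 2`.
  have hk : 1 ≤ n → 2 ≤ k := by
    intro hn
    by_contra hk
    obtain rfl : k = 1 := by omega
    rw [show Module.finrank F S_u = 0 by omega, pow_zero, pow_one] at hlen
    omega
  refine ⟨fun i j => subspaceCount G (k - j) (n - i), hlen, ?_, ?_⟩
  · rw [weightEnumerator, Finset.sum_range_succ', weightCount_zero, add_comm,
      Finset.range_eq_Ico, Finset.sum_Ico_add' (fun i =>
        Polynomial.C (weightCount (liftedCode L G) i : ℚ) * Polynomial.X ^ i) 0 n 1]
    congr 1
    · simp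
    · refine Finset.sum_congr (by ext; simp) fun i hi => ?_
      obtain ⟨h1, h2⟩ := Finset.mem_Icc.1 hi
      rw [weightCount_liftedCode G
        (colEval_injective hS₁ hd hexc hG (hk (h1.trans h2))) h2, Finset.sum_range_succ',
        ← Finset.sum_mul, ← map_sum]
      congr 2
      -- The term `j = 0` belongs to the zero map: its kernel contains all `n` columns, more than `n
      -- - i` since `i ≥ 1`.
      have h0 : subspaceCount G (k - 0) (n - i) = 0 := by
        rw [subspaceCount]
        convert Set.ncard_empty (Submodule F (Fin k → F))
        refine Set.eq_empty_of_forall_notMem fun V ⟨hV, hc⟩ => ?_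
        obtain rfl : V = ⊤ := Submodule.eq_top_of_finrank_eq (by rw [hV]; simp)
        simp only [Submodule.mem_top, Set.ofPred_true, Set.ncard_univ, Nat.card_fin] at hc
        omega
      rw [h0, Nat.cast_zero, zero_mul, add_zero, Finset.range_eq_Ico,
        Finset.sum_Ico_add' (fun j => (subspaceCount G (k - j) (n - i) : ℚ) *
          ∏ r ∈ Finset.range j,
            ((Nat.card F : ℚ) ^ Module.finrank F L - (Nat.card F : ℚ) ^ r)) 0 k 1]
      exact Finset.sum_congr (by ext; simp) fun _ _ => rfl
  · intro i hi j hj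
    obtain ⟨h1, h2⟩ := Finset.mem_Icc.1 hi
    obtain ⟨h3, h4⟩ := Finset.mem_Icc.1 hj
    have hsub := Nat.cast_sub (R := ℤ) h4
    rw [← Nat.cast_sub h2]
    beta_reduce
    refine ⟨rfl, ?_, fun hm => ?_, fun t ht hm => ?_, fun t ht hm => ?_, fun ha hb hc => ?_⟩
    · exact congrArg Nat.cast (subcodeCount_rowCode G
        (colEval_injective hS₁ hd hexc hG (hk (h1.trans h2))) h2 h4).symm
    · have key := subspaceCount_formula_collision hcard (Module.finrank F S_u)
        (k - Module.finrank F S_u - 1) ((k : ℤ) - j)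
      have e1 : ((k - Module.finrank F S_u - 1 : ℕ) : ℤ) = (k : ℤ) - Module.finrank F S_u - 1 := by
        omega
      rw [e1, sub_add_cancel] at key
      rw [← key, subspaceCount_of_eq_pow_sub hS₁ hd hG hm, Nat.cast_add,
        ncard_submodule_avoiding hS₁ hd, ncard_submodule_containing hS₁ hd, hsub]
    · rw [subspaceCount_of_eq_pow_sub_pow hS₁ hd hG ht hm, ncard_submodule_avoiding hS₁ hd, hsub]
    · rw [subspaceCount_of_eq_pow_sub_pow_sub hS₁ hd hG ht hm, ncard_submodule_containing hS₁ hd,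
        hsub]
    · exact congrArg Nat.cast (subspaceCount_eq_zero hS₁ hd hG ha hb hc)
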